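/- Let $\mathcal H$ be a real Hilbert space and $r\in(0,\infty)$. For a nonempty closed set $K\subseteq\mathcal H$ and $y\in\mathcal H$ put $d_K(y):=\inf_{z\in K}\|z-y\|$ and $\mathrm{Proj}_K(y):=\{x\in K:\ \|x-y\|=d_K(y)\}$, and for $x\in K$ let $$N_K(x):=\{\lambda(y-x):\ y\in\mathcal H,\ x\in \mathrm{Proj}_K(y),\ \lambda\ge 0\}$$ be the (exterior proximal) normal cone. The set $K$ is called $r$-prox-regular if for every $y$ with $0<d_K(y)<r$ one has $\mathrm{Proj}_K(y)\neq\varnothing$ and $x\in \mathrm{Proj}_K\bigl(x+r\frac{y-x}{\|y-x\|}\bigr)$ for every $x\in \mathrm{Proj}_K(y)$; if $d_K(y)<r$ and $K$ is $r$-prox-regular, $P_K(y)$ denotes the unique element of $\mathrm{Proj}_K(y)$. The excess of $Z_1\subseteq\mathcal H$ over $Z_2\subseteq\mathcal H$ is $e(Z_1,Z_2):=\sup_{z\in Z_1}\inf_{w\in Z_2}\|z-w\|\in[0,\infty]$. **Theorem.** For every $t\in[0,\infty)$ let $C(t)$ be a nonempty closed $r$-prox-regular subset of $\mathcal H$, and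 assume that $e(C(s),C(t))\le t-s$ for all $0\le s<t$. Let $y_0\in C(0)+B_r(0)$, where $B_r(0)$ is the open ball of radius $r$ centred at $0$. Then there exists a unique locally absolutely continuous function $y:[0,\infty)\to\mathcal H$ such that 1. $y(t)\in C(t)$ for every $t\in[0,\infty)$, 2. for Lebesgue-a.e. $t\in[0,\infty)$ the derivative $y'(t)$ exists and $y'(t)\in -N_{C(t)}(y(t))$, 3. $y(0)=P_{C(0)}(y_0)$. Moreover $y$ is Lipschitz continuous on $[0,\infty)$ with Lipschitz constant at most $1$. -/

import Mathlib

/-- The set of nearest points of `K` to `y`. -/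
def projSet {H : Type*} [NormedAddCommGroup H] (K : Set H) (y : H) : Set H :=
  {x | x ∈ K ∧ ‖x - y‖ = Metric.infDist y K}

/-- The (exterior, proximal) normal cone of `K` at `x`. -/
def normalCone {H : Type*} [NormedAddCommGroup H] [InnerProductSpace ℝ H]
    (K : Set H) (x : H) : Set H :=
  {u | ∃ (y : H) (a : ℝ), 0 ≤ a ∧ x ∈ projSet K y ∧ u = a • (y - x)}

/-- `K` is (nonempty, closed and) `r`-prox-regular. -/
structure IsProxRegular {H : Type*} [NormedAddCommGroup H] [InnerProductSpace ℝ H]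
    (r : ℝ) (K : Set H) : Prop where
  nonempty : K.Nonempty
  isClosed : IsClosed K
  exists_proj : ∀ y : H, 0 < Metric.infDist y K → Metric.infDist y K < r →
    (projSet K y).Nonempty
  mem_proj : ∀ y : H, 0 < Metric.infDist y K → Metric.infDist y K < r →
    ∀ x ∈ projSet K y, x ∈ projSet K (x + r • (‖y - x‖⁻¹ • (y - x)))

/-- The excess of `Z₁` over `Z₂`, an extended nonnegative real. -/
noncomputable def excess {H : Type*} [NormedAddCommGroup H] (Z₁ Z₂ : Set H) : ENNReal :=
  ⨆ z ∈ Z₁, Metric.infEDist z Z₂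

/-- `y` solves on `[0, ∞)` the sweeping process driven by `C` with initial datum `y₀`.
Only the values of `C` and `y` on `[0, ∞)` matter. -/
structure IsSweepingSolution {H : Type*} [NormedAddCommGroup H] [InnerProductSpace ℝ H]
    (C : ℝ → Set H) (y₀ : H) (y : ℝ → H) : Prop where
  /-- `y` is locally absolutely continuous on `[0, ∞)`. -/
  absCont : ∀ T : ℝ, 0 < T → AbsolutelyContinuousOnInterval y 0 T
  mem : ∀ t : ℝ, 0 ≤ t → y t ∈ C t
  /-- `y'(t)` exists and belongs to `-N_{C(t)}(y(t))` for almost every `t ≥ 0`. -/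
  inclusion : ∀ᵐ t ∂(MeasureTheory.volume.restrict (Set.Ici (0 : ℝ))),
    ∃ v : H, HasDerivWithinAt y v (Set.Ici 0) t ∧ -v ∈ normalCone (C t) (y t)
  /-- `y(0)` is the (unique) nearest point of `C(0)` to `y₀`. -/
  initial : projSet (C 0) y₀ = {y 0}

open MeasureTheory Filter Topology Set

/-! Prox-regularity enters through one inequality: a proximal normal `u` at `x` satisfies `2r⟨u, z -
x⟩ ≤ ‖u‖ ‖z - x‖²` for all `z` in the set (`IsProxRegular.inner_le_of_mem_normalCone`). Up to a
quadratic error, projections then behave as onto convex sets.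

Existence: in Moreau's scheme with time step `h`, the excess bound makes every projection move by at
most `h`. By the inequality, one coarse step and two half steps increase the squared gap between the
two schemes by at most a factor `1 + 4h/r` and a term `10h²`. Over a bounded time interval the gap
is therefore `O(√h)`, which is summable along successive halvings, so the schemes converge. The
limit is `1`-Lipschitz, stays in the moving set and inherits an integrated variational inequality
(`exists_lipschitz_evi_curve`). Differentiating this inequality at each point of differentiability
gives the normal cone inclusion directly, with no weak limit of velocities.

Uniqueness: looking backward in time, any solution has speed at most `1` almost everywhere
(`norm_le_one_of_neg_mem_normalCone`). Adding the normal inequalities for two solutions gives `(‖y -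
z‖²)' ≤ (2/r) ‖y - z‖²`, and Gronwall concludes. -/

/-! ### Almost everywhere differentiability of Lipschitz curves in Hilbert spaces. -/

theorem Orthonormal.countable_of_separableSpace {G : Type*} [NormedAddCommGroup G]
    [InnerProductSpace ℝ G] [TopologicalSpace.SeparableSpace G] {ι : Type*} {b : ι → G}
    (hb : Orthonormal ℝ b) : Countable ι := by
  have hdist : ∀ i j, i ≠ j → 1 ≤ dist (b i) (b j) := by
    intro i j hij
    have h := norm_sub_sq_real (b i) (b j)
    rw [hb.1 i, hb.1 j, hb.2 hij] at h
    rw [dist_eq_norm]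
    nlinarith [norm_nonneg (b i - b j)]
  have hinj : Function.Injective b := hb.linearIndependent.injective
  have : SecondCountableTopology G := UniformSpace.secondCountable_of_separable G
  have hd : DiscreteTopology (range b) := by
    refine DiscreteTopology.of_forall_le_dist (r := 1) one_pos ?_
    rintro ⟨_, i, rfl⟩ ⟨_, j, rfl⟩ hij
    exact hdist i j fun h => hij (by simp [h])
  have hc : Countable (range b) := TopologicalSpace.separableSpace_iff_countable.1 inferInstance
  exact (Equiv.ofInjective b hinj).countable_iff.2 hc

/-- A Lipschitz curve in a separable Hilbert space is almost everywhere differentiable. -/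
theorem LipschitzWith.ae_differentiableAt_of_separable {G : Type*} [NormedAddCommGroup G]
    [InnerProductSpace ℝ G] [CompleteSpace G] [TopologicalSpace.SeparableSpace G]
    {L : NNReal} {f : ℝ → G} (hf : LipschitzWith L f) : ∀ᵐ t, DifferentiableAt ℝ f t := by
  obtain ⟨w, b, -⟩ := exists_hilbertBasis ℝ G
  have : Countable w := b.orthonormal.countable_of_separableSpace
  let c : w → ℝ → ℝ := fun i s => inner ℝ (b i) (f s)
  have hc : ∀ i, LipschitzWith L (c i) := by
    intro i
    refine LipschitzWith.of_dist_le_mul fun s t => ?_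
    rw [Real.dist_eq, ← inner_sub_right]
    refine (abs_real_inner_le_norm _ _).trans ?_
    rw [b.orthonormal.1 i, one_mul, ← dist_eq_norm]
    exact hf.dist_le_mul s t
  have hdiff : ∀ᵐ t, ∀ i, DifferentiableAt ℝ (c i) t :=
    ae_all_iff.2 fun i => (hc i).ae_differentiableAt_real
  -- The candidate derivative `g` is assembled from the coordinate derivatives. Bessel's inequality
  -- for the difference quotients bounds its norm by `L`; `f` is then recovered from the primitive
  -- of `g`.
  let S : Finset w → ℝ → G := fun s t => ∑ i ∈ s, deriv (c i) t • b i
  let g : ℝ → G := fun t => ∑' i, deriv (c i) t • b i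
  have hbound : ∀ t, (∀ i, DifferentiableAt ℝ (c i) t) → ∀ s : Finset w,
      ∑ i ∈ s, deriv (c i) t ^ 2 ≤ (L : ℝ) ^ 2 := by
    intro t ht s
    have hlim : Tendsto (fun x => ∑ i ∈ s, slope (c i) t x ^ 2) (𝓝[≠] t)
        (𝓝 (∑ i ∈ s, deriv (c i) t ^ 2)) :=
      tendsto_finsetSum _ fun i _ => ((ht i).hasDerivAt.tendsto_slope).pow 2
    refine le_of_tendsto hlim ?_
    filter_upwards [self_mem_nhdsWithin] with x hx
    have h1 : ∀ i, slope (c i) t x = inner ℝ (b i) (slope f t x) := by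
      intro i
      simp [slope, c, inner_smul_right, inner_sub_right]
    have h2 : ∑ i ∈ s, ‖inner ℝ (b i) (slope f t x)‖ ^ 2 ≤ ‖slope f t x‖ ^ 2 :=
      b.orthonormal.sum_inner_products_le _
    have h3 : ‖slope f t x‖ ≤ L := by
      have hx' : 0 < |x - t| := abs_pos.2 (sub_ne_zero.2 hx)
      rw [slope_def_module, norm_smul, norm_inv, Real.norm_eq_abs, ← div_eq_inv_mul,
        div_le_iff₀ hx', ← Real.dist_eq, ← dist_eq_norm]
      exact hf.dist_le_mul x t
    calc ∑ i ∈ s, slope (c i) t x ^ 2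
        = ∑ i ∈ s, ‖inner ℝ (b i) (slope f t x)‖ ^ 2 := by simp [h1]
      _ ≤ ‖slope f t x‖ ^ 2 := h2
      _ ≤ (L : ℝ) ^ 2 := by gcongr
  have hsum : ∀ t, (∀ i, DifferentiableAt ℝ (c i) t) →
      HasSum (fun i => deriv (c i) t • b i) (g t) ∧
        (∀ i, inner ℝ (b i) (g t) = deriv (c i) t) ∧ ‖g t‖ ≤ L := by
    intro t ht
    have hmem : Memℓp (fun i => deriv (c i) t) 2 := by
      refine memℓp_gen' (C := (L : ℝ) ^ 2) fun s => ?_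
      simpa using hbound t ht s
    have h := b.hasSum_repr_symm ⟨_, hmem⟩
    have hg : g t = b.repr.symm ⟨_, hmem⟩ := h.tsum_eq
    refine ⟨hg ▸ h, fun i => ?_, ?_⟩
    · rw [← b.repr_apply_apply, hg, LinearIsometryEquiv.apply_symm_apply]
    · rw [← hg] at h
      refine le_of_tendsto h.norm (Eventually.of_forall fun s => ?_)
      have h4 : ‖∑ i ∈ s, deriv (c i) t • b i‖ ^ 2 = ∑ i ∈ s, deriv (c i) t ^ 2 := by
        rw [← real_inner_self_eq_norm_sq, b.orthonormal.inner_sum]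
        simp [sq]
      exact le_of_sq_le_sq (h4.trans_le (hbound t ht s)) L.2
  borelize G
  have : SecondCountableTopology G := UniformSpace.secondCountable_of_separable G
  have hmeas : AEStronglyMeasurable g volume := by
    refine aestronglyMeasurable_of_tendsto_ae (u := atTop) (f := S) (fun s => ?_) ?_
    · exact (Finset.stronglyMeasurable_fun_sum s fun i _ =>
        (stronglyMeasurable_deriv (c i)).smul_const (b i)).aestronglyMeasurable
    · filter_upwards [hdiff] with t ht using (hsum t ht).1
  have hgL : ∀ᵐ t, ‖g t‖ ≤ L := by
    filter_upwards [hdiff] with t ht using (hsum t ht).2.2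
  have hgloc : LocallyIntegrable g volume := by
    refine LocallyIntegrable.mono (f := fun _ => (L : ℝ)) (locallyIntegrable_const _) hmeas ?_
    filter_upwards [hgL] with t ht
    simpa using ht
  have hgint : ∀ x y : ℝ, IntervalIntegrable g volume x y := fun x y =>
    intervalIntegrable_iff.2
      ((hgloc.integrableOn_isCompact isCompact_uIcc).mono_set uIoc_subset_uIcc)
  have hF := _root_.LocallyIntegrable.ae_hasDerivAt_integral hgloc
  let F : ℝ → G := fun x => ∫ t in (0 : ℝ)..x, g t
  have hFL : LipschitzWith L F := by
    refine LipschitzWith.of_dist_le_mul fun x y => ?_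
    rw [dist_eq_norm, intervalIntegral.integral_interval_sub_left (hgint _ _) (hgint _ _),
      Real.dist_eq]
    exact intervalIntegral.norm_integral_le_of_norm_le_const_ae (hgL.mono fun t ht _ => ht)
  -- Each coordinate of `f - F` is Lipschitz with derivative zero almost everywhere, hence constant.
  have hconst : ∀ x, f x - F x = f 0 := by
    intro x
    have hcoord : ∀ i, inner ℝ (b i) (f x - F x) = inner ℝ (b i) (f 0) := by
      intro i
      let φ : ℝ → ℝ := fun s => inner ℝ (b i) (f s - F s)
      have hφL : LipschitzWith (L + L) φ := by
        refine LipschitzWith.of_dist_le_mul fun s t => ?_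
        rw [Real.dist_eq, ← inner_sub_right]
        refine (abs_real_inner_le_norm _ _).trans ?_
        rw [b.orthonormal.1 i, one_mul, ← dist_eq_norm]
        exact (hf.sub hFL).dist_le_mul s t
      have hφ0 : ∀ᵐ t, t ∈ uIcc 0 x → HasDerivAt φ 0 t := by
        filter_upwards [hdiff, hF] with t ht hFt _
        have h1 : HasDerivAt (fun s => inner ℝ (b i) (F s)) (inner ℝ (b i) (g t)) t := by
          simpa using (hasDerivAt_const t (b i)).inner ℝ (hFt 0)
        have h2 := (ht i).hasDerivAt.sub h1
        rw [(hsum t ht).2.1 i, sub_self] at h2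
        refine h2.congr_of_eventuallyEq (Eventually.of_forall fun s => ?_)
        simp [φ, c, inner_sub_right]
      obtain ⟨C, hC⟩ := ((hφL.lipschitzOnWith (s := uIcc 0 x)).absolutelyContinuousOnInterval
        ).const_of_ae_hasDerivAt_zero hφ0
      have := (hC x right_mem_uIcc).trans (hC 0 left_mem_uIcc).symm
      simpa [φ, F] using this
    apply b.repr.injective
    ext i
    rw [b.repr_apply_apply, b.repr_apply_apply, hcoord i]
  filter_upwards [hF] with t ht
  have h1 : HasDerivAt (fun x => f 0 + F x) (g t) t := (ht 0).const_add _
  have h2 : f = fun x => f 0 + F x := funext fun x => by rw [← hconst x]; abel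
  rw [h2]
  exact h1.differentiableAt

/-- A Lipschitz curve in a Hilbert space is almost everywhere differentiable. -/
theorem LipschitzWith.ae_differentiableAt_of_hilbert {H : Type*} [NormedAddCommGroup H]
    [InnerProductSpace ℝ H] [CompleteSpace H] {L : NNReal} {f : ℝ → H} (hf : LipschitzWith L f) :
    ∀ᵐ t, DifferentiableAt ℝ f t := by
  -- The curve lives in the closed span of its range, which is separable.
  let K : Submodule ℝ H := (Submodule.span ℝ (range f)).topologicalClosure
  have hfK : ∀ t, f t ∈ K := fun t =>
    Submodule.le_topologicalClosure _ (Submodule.subset_span (mem_range_self t))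
  have hsep : TopologicalSpace.IsSeparable (K : Set H) :=
    ((TopologicalSpace.isSeparable_range hf.continuous).span).closure
  have : TopologicalSpace.SeparableSpace K := hsep.separableSpace
  have : CompleteSpace K := (Submodule.isClosed_topologicalClosure _).completeSpace_coe
  have h : LipschitzWith L (fun t => (⟨f t, hfK t⟩ : K)) := fun s t => hf s t
  filter_upwards [h.ae_differentiableAt_of_separable] with t ht
  exact K.subtypeL.differentiableAt.comp t ht

/-! ### Normal inequalities for prox-regular sets. -/

section ProxRegular

variable {H : Type*} [NormedAddCommGroup H] {K : Set H} {x y z : H}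

theorem norm_sub_le_of_mem_projSet (hx : x ∈ projSet K y) (hz : z ∈ K) : ‖x - y‖ ≤ ‖z - y‖ := by
  rw [hx.2, ← dist_eq_norm, dist_comm]
  exact Metric.infDist_le_dist_of_mem hz

theorem mem_projSet_of_forall_norm_sub_le (hx : x ∈ K) (h : ∀ z ∈ K, ‖x - y‖ ≤ ‖z - y‖) :
    x ∈ projSet K y := by
  refine ⟨hx, le_antisymm ?_ ?_⟩
  · refine (Metric.le_infDist ⟨x, hx⟩).2 fun z hz => ?_
    rw [dist_comm, dist_eq_norm]
    exact h z hz
  · rw [← dist_eq_norm, dist_comm]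
    exact Metric.infDist_le_dist_of_mem hx

variable [InnerProductSpace ℝ H] {r : ℝ}

/-- Moving the base point towards its projection keeps the projection. -/
theorem mem_projSet_segment (hx : x ∈ projSet K y) {s : ℝ} (hs0 : 0 ≤ s) (hs1 : s ≤ 1) :
    x ∈ projSet K (x + s • (y - x)) := by
  refine mem_projSet_of_forall_norm_sub_le hx.1 fun z hz => ?_
  have h1 := norm_sub_le_of_mem_projSet hx hz
  have h2 : ‖x - (x + s • (y - x))‖ = s * ‖x - y‖ := by
    rw [sub_add_cancel_left, norm_neg, norm_smul, Real.norm_of_nonneg hs0, norm_sub_rev]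
  have h3 : ‖x + s • (y - x) - y‖ = (1 - s) * ‖x - y‖ := by
    have : x + s • (y - x) - y = (1 - s) • (x - y) := by module
    rw [this, norm_smul, Real.norm_of_nonneg (by linarith)]
  have h4 := norm_sub_le_norm_sub_add_norm_sub z (x + s • (y - x)) y
  linarith

theorem IsProxRegular.projSet_nonempty (hK : IsProxRegular r K) (h : Metric.infDist y K < r) :
    (projSet K y).Nonempty := by
  rcases (Metric.infDist_nonneg (x := y) (s := K)).eq_or_lt with h0 | h0
  · refine ⟨y, (hK.isClosed.mem_iff_infDist_zero hK.nonempty).2 h0.symm, ?_⟩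
    simp [← h0]
  · exact hK.exists_proj y h0 h

/-- Prox-normal vectors of a prox-regular set satisfy a quadratic one-sided estimate. -/
theorem IsProxRegular.inner_le (hr : 0 < r) (hK : IsProxRegular r K) (hx : x ∈ projSet K y)
    (hz : z ∈ K) : 2 * r * inner ℝ (y - x) (z - x) ≤ ‖y - x‖ * ‖z - x‖ ^ 2 := by
  rcases eq_or_ne y x with rfl | hne
  · simp
  have hpos : 0 < ‖y - x‖ := norm_pos_iff.2 (sub_ne_zero.2 hne)
  -- Prox-regularity speaks only of points at distance less than `r`. Sliding `y` towards `x` until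
  -- the distance is at most `r / 2` keeps both the projection and the direction, so no bound on `‖y
  -- - x‖` is needed.
  set s : ℝ := min 1 (r / (2 * ‖y - x‖)) with hs
  have hs0 : 0 < s := by positivity
  have hs1 : s ≤ 1 := min_le_left _ _
  have hp := mem_projSet_segment hx hs0.le hs1
  have hd : Metric.infDist (x + s • (y - x)) K = s * ‖y - x‖ := by
    rw [← hp.2, sub_add_cancel_left, norm_neg, norm_smul, Real.norm_of_nonneg hs0.le]
  have hlt : s * ‖y - x‖ < r := by
    have : s * ‖y - x‖ ≤ r / (2 * ‖y - x‖) * ‖y - x‖ := by gcongr; exact min_le_right _ _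
    have h2 : r / (2 * ‖y - x‖) * ‖y - x‖ = r / 2 := by field_simp
    linarith
  have hq := hK.mem_proj _ (by rw [hd]; positivity) (by rw [hd]; exact hlt) x hp
  have he : ‖x + s • (y - x) - x‖⁻¹ • (x + s • (y - x) - x) = ‖y - x‖⁻¹ • (y - x) := by
    rw [add_sub_cancel_left, norm_smul, Real.norm_of_nonneg hs0.le, smul_smul]
    congr 1
    field_simp
  rw [he] at hq
  have h1 := norm_sub_le_of_mem_projSet hq hz
  have hn : ‖x - (x + r • (‖y - x‖⁻¹ • (y - x)))‖ = r := by
    rw [sub_add_cancel_left, norm_neg, norm_smul, norm_smul, norm_inv, norm_norm,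
      inv_mul_cancel₀ hpos.ne', mul_one, Real.norm_of_nonneg hr.le]
  have h2 : ‖z - (x + r • (‖y - x‖⁻¹ • (y - x)))‖ ^ 2
      = ‖z - x‖ ^ 2 - 2 * (r * (‖y - x‖⁻¹ * inner ℝ (y - x) (z - x))) + r ^ 2 := by
    rw [← sub_sub, norm_sub_sq_real, real_inner_smul_right, real_inner_smul_right,
      real_inner_comm, norm_smul, norm_smul, norm_inv, norm_norm,
      inv_mul_cancel₀ hpos.ne', mul_one, Real.norm_of_nonneg hr.le]
  rw [hn] at h1
  have h3 : r ^ 2 ≤ ‖z - (x + r • (‖y - x‖⁻¹ • (y - x)))‖ ^ 2 := by gcongr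
  have h4 : 2 * r * (‖y - x‖⁻¹ * inner ℝ (y - x) (z - x)) ≤ ‖z - x‖ ^ 2 := by linarith
  calc 2 * r * inner ℝ (y - x) (z - x)
      = ‖y - x‖ * (2 * r * (‖y - x‖⁻¹ * inner ℝ (y - x) (z - x))) := by field_simp
    _ ≤ ‖y - x‖ * ‖z - x‖ ^ 2 := by gcongr

theorem IsProxRegular.inner_le_of_mem_normalCone (hr : 0 < r) (hK : IsProxRegular r K) {u : H}
    (hu : u ∈ normalCone K x) (hz : z ∈ K) : 2 * r * inner ℝ u (z - x) ≤ ‖u‖ * ‖z - x‖ ^ 2 := by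
  obtain ⟨y, a, ha, hx, rfl⟩ := hu
  have h := mul_le_mul_of_nonneg_left (hK.inner_le hr hx hz) ha
  rw [real_inner_smul_left, norm_smul, Real.norm_of_nonneg ha]
  linarith

/-- The hypothesis is the expanded square of `‖r u‖ ≤ ‖z - (x + r u)‖`, so `x` is a nearest point to
`x + r u`. Prox-regularity plays no role. -/
theorem mem_normalCone_of_inner_le (hr : 0 < r) {u : H} (hx : x ∈ K)
    (h : ∀ z ∈ K, 2 * r * inner ℝ u (z - x) ≤ ‖z - x‖ ^ 2) : u ∈ normalCone K x := by
  refine ⟨x + r • u, r⁻¹, by positivity, mem_projSet_of_forall_norm_sub_le hx fun z hz => ?_, ?_⟩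
  · refine le_of_sq_le_sq ?_ (norm_nonneg _)
    rw [sub_add_cancel_left, norm_neg, ← sub_sub, norm_sub_sq_real, real_inner_smul_right,
      real_inner_comm]
    linarith [h z hz]
  · rw [add_sub_cancel_left, smul_smul, inv_mul_cancel₀ hr.ne', one_smul]

/-- Adding the normal inequalities at two nearest points `a`, `b` gives `r ‖b - a‖² ≤ d ‖b - a‖²`
with `d < r` the distance to `K`. -/
theorem IsProxRegular.projSet_subsingleton (hr : 0 < r) (hK : IsProxRegular r K)
    (h : Metric.infDist y K < r) : (projSet K y).Subsingleton := by
  intro a ha b hb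
  have h1 := hK.inner_le hr ha hb.1
  have h2 := hK.inner_le hr hb ha.1
  rw [norm_sub_rev, ha.2] at h1
  rw [norm_sub_rev y, hb.2, norm_sub_rev a b] at h2
  have h3 : inner ℝ (y - a) (b - a) + inner ℝ (y - b) (a - b) = ‖b - a‖ ^ 2 := by
    rw [← neg_sub b a, inner_neg_right, ← sub_eq_add_neg, ← inner_sub_left,
      ← real_inner_self_eq_norm_sq]
    congr 1
    abel
  have h4 : (r - Metric.infDist y K) * ‖b - a‖ ^ 2 ≤ 0 := by linarith [congrArg (r * ·) h3]
  have h5 : ‖b - a‖ ^ 2 ≤ 0 := by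
    by_contra! hc
    linarith [mul_pos (sub_pos.2 h) hc]
  have h6 : ‖b - a‖ = 0 := by
    have := sq_nonneg ‖b - a‖
    exact pow_eq_zero_iff two_ne_zero |>.1 (le_antisymm h5 this)
  exact (sub_eq_zero.1 (norm_eq_zero.1 h6)).symm

/-- One projection step decreases the squared distance to points near `K`, up to an error. -/
theorem IsProxRegular.norm_sq_projection_step_le (hr : 0 < r) (hK : IsProxRegular r K) {p : H}
    {h ε : ℝ} (hp : p ∈ projSet K x) (hpx : ‖p - x‖ ≤ h) (hz : Metric.infDist z K ≤ ε)
    (hε : ε < r) :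
    r * ‖p - z‖ ^ 2 ≤ r * ‖x - z‖ ^ 2 + h * (‖p - z‖ + ε) ^ 2 + 2 * r * h * ε := by
  -- The normal inequality at `p` needs a point of `K`; `z` is replaced by a nearest point, at a
  -- cost controlled by `ε`.
  obtain ⟨z', hz'⟩ := hK.projSet_nonempty (hz.trans_lt hε)
  have hzz : ‖z' - z‖ ≤ ε := hz'.2.trans_le hz
  have h0 : 0 ≤ h := (norm_nonneg _).trans hpx
  have h1 := hK.inner_le hr hp hz'.1
  have h2 : ‖x - z‖ ^ 2 = ‖x - p‖ ^ 2 + 2 * inner ℝ (x - p) (p - z) + ‖p - z‖ ^ 2 := by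
    rw [← norm_add_sq_real, sub_add_sub_cancel]
  have h3 : inner ℝ (x - p) (p - z) = - inner ℝ (x - p) (z' - p) + inner ℝ (x - p) (z' - z) := by
    rw [← inner_neg_right, ← inner_add_right]
    congr 1
    abel
  have hxp : ‖x - p‖ ≤ h := by rwa [norm_sub_rev]
  have h4 : -(h * ε) ≤ inner ℝ (x - p) (z' - z) := by
    have := neg_le_of_abs_le (abs_real_inner_le_norm (x - p) (z' - z))
    have : ‖x - p‖ * ‖z' - z‖ ≤ h * ε := by gcongr
    linarith
  have h5 : ‖z' - p‖ ≤ ‖p - z‖ + ε := by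
    have := norm_sub_le_norm_sub_add_norm_sub z' z p
    rw [norm_sub_rev z p] at this
    linarith
  have h6 : ‖x - p‖ * ‖z' - p‖ ^ 2 ≤ h * (‖p - z‖ + ε) ^ 2 := by gcongr
  have h7 := mul_le_mul_of_nonneg_left h4 hr.le
  have h8 := mul_nonneg hr.le (sq_nonneg ‖x - p‖)
  rw [h2, h3]
  nlinarith

end ProxRegular

/-! ### The catching-up scheme: estimates and convergence. -/

section CatchingUp

variable {H : Type*} [NormedAddCommGroup H]

open Classical in
/-- A nearest point of `K` to `y`, if there is one, and `y` otherwise. -/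
noncomputable def nearestPoint (K : Set H) (y : H) : H :=
  if h : (projSet K y).Nonempty then h.some else y

theorem nearestPoint_mem {K : Set H} {y : H} (h : (projSet K y).Nonempty) :
    nearestPoint K y ∈ projSet K y := by
  rw [nearestPoint, dif_pos h]
  exact h.some_mem

/-- Moreau's catching-up scheme with time step `h`. -/
noncomputable def catchingUp (C : ℝ → Set H) (x₀ : H) (h : ℝ) : ℕ → H
  | 0 => x₀
  | k + 1 => nearestPoint (C ((k + 1 : ℕ) * h)) (catchingUp C x₀ h k)

/-- The piecewise constant interpolation of the catching-up scheme. -/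
noncomputable def catchingUpStep (C : ℝ → Set H) (x₀ : H) (h t : ℝ) : H :=
  catchingUp C x₀ h ⌊t / h⌋₊

variable [InnerProductSpace ℝ H] {r : ℝ} {C : ℝ → Set H} {x₀ : H} {h : ℝ}

theorem catchingUp_mem_projSet (hC : ∀ t, 0 ≤ t → IsProxRegular r (C t))
    (hd : ∀ s t, 0 ≤ s → s ≤ t → ∀ x ∈ C s, Metric.infDist x (C t) ≤ t - s) (hx₀ : x₀ ∈ C 0)
    (h0 : 0 < h) (hr : h < r) (k : ℕ) :
    catchingUp C x₀ h k ∈ C (k * h) ∧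
      catchingUp C x₀ h (k + 1) ∈ projSet (C ((k + 1 : ℕ) * h)) (catchingUp C x₀ h k) := by
  have key : ∀ k : ℕ, catchingUp C x₀ h k ∈ C (k * h) →
      catchingUp C x₀ h (k + 1) ∈ projSet (C ((k + 1 : ℕ) * h)) (catchingUp C x₀ h k) := by
    intro k hk
    refine nearestPoint_mem ((hC _ (by positivity)).projSet_nonempty ?_)
    refine (hd (k * h) _ (by positivity) ?_ _ hk).trans_lt ?_ <;> push_cast <;> linarith
  have hmem : catchingUp C x₀ h k ∈ C (k * h) := by
    induction k with
    | zero => simpa [catchingUp] using hx₀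
    | succ k ih => exact (key k ih).1
  exact ⟨hmem, key k hmem⟩

theorem norm_catchingUp_succ_sub_le (hC : ∀ t, 0 ≤ t → IsProxRegular r (C t))
    (hd : ∀ s t, 0 ≤ s → s ≤ t → ∀ x ∈ C s, Metric.infDist x (C t) ≤ t - s) (hx₀ : x₀ ∈ C 0)
    (h0 : 0 < h) (hr : h < r) (k : ℕ) :
    ‖catchingUp C x₀ h (k + 1) - catchingUp C x₀ h k‖ ≤ h := by
  obtain ⟨h1, h2⟩ := catchingUp_mem_projSet hC hd hx₀ h0 hr k
  rw [h2.2]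
  refine (hd (k * h) _ (by positivity) ?_ _ h1).trans ?_ <;> push_cast <;> linarith

theorem norm_catchingUp_add_sub_le (hC : ∀ t, 0 ≤ t → IsProxRegular r (C t))
    (hd : ∀ s t, 0 ≤ s → s ≤ t → ∀ x ∈ C s, Metric.infDist x (C t) ≤ t - s) (hx₀ : x₀ ∈ C 0)
    (h0 : 0 < h) (hr : h < r) (k m : ℕ) :
    ‖catchingUp C x₀ h (k + m) - catchingUp C x₀ h k‖ ≤ m * h := by
  induction m with
  | zero => simp
  | succ m ih =>
    have h1 := norm_catchingUp_succ_sub_le hC hd hx₀ h0 hr (k + m)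
    have h2 := norm_sub_le_norm_sub_add_norm_sub (catchingUp C x₀ h (k + m + 1))
      (catchingUp C x₀ h (k + m)) (catchingUp C x₀ h k)
    rw [← add_assoc]
    push_cast
    linarith

/-- Discrete evolution variational inequality for the catching-up scheme. -/
theorem catchingUp_norm_sq_le (hC : ∀ t, 0 ≤ t → IsProxRegular r (C t))
    (hd : ∀ s t, 0 ≤ s → s ≤ t → ∀ x ∈ C s, Metric.infDist x (C t) ≤ t - s) (hx₀ : x₀ ∈ C 0)
    (h0 : 0 < h) (hr : h < r) {t δ : ℝ} (ht : 0 ≤ t) (hδ : δ < r) {z : H} (hz : z ∈ C t)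
    {k m : ℕ} (hk : t ≤ (k + 1) * h) (hm : (k + m) * h ≤ t + δ) :
    r * ‖catchingUp C x₀ h (k + m) - z‖ ^ 2 ≤ r * ‖catchingUp C x₀ h k - z‖ ^ 2 +
      m * h * ((‖catchingUp C x₀ h k - z‖ + m * h + δ) ^ 2 + 2 * r * δ) := by
  set B := (‖catchingUp C x₀ h k - z‖ + m * h + δ) ^ 2 + 2 * r * δ with hB
  suffices ∀ j ≤ m, r * ‖catchingUp C x₀ h (k + j) - z‖ ^ 2 ≤
      r * ‖catchingUp C x₀ h k - z‖ ^ 2 + j * h * B from this m le_rfl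
  intro j
  induction j with
  | zero => simp
  | succ j ih =>
    intro hj
    have h1 := ih (by omega)
    have hjm : (j + 1 : ℝ) ≤ m := by exact_mod_cast hj
    have hjm' : (j + 1 : ℝ) * h ≤ m * h := by gcongr
    have hj0 : 0 ≤ (j : ℝ) * h := by positivity
    -- The node `(k + j + 1) h` lies in `[t, t + δ]`, so the forward excess alone brings `z` within
    -- `δ` of the set there.
    have hinf : Metric.infDist z (C ((k + j + 1 : ℕ) * h)) ≤ δ := by
      refine (hd t _ ht ?_ z hz).trans ?_ <;> push_cast <;> nlinarith
    have hδ0 : 0 ≤ δ := Metric.infDist_nonneg.trans hinf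
    have h2 := (hC _ (by positivity)).norm_sq_projection_step_le (h0.trans hr)
      (catchingUp_mem_projSet hC hd hx₀ h0 hr (k + j)).2
      (norm_catchingUp_succ_sub_le hC hd hx₀ h0 hr (k + j)) hinf hδ
    have h3 := norm_catchingUp_add_sub_le hC hd hx₀ h0 hr k (j + 1)
    have h4 := norm_sub_le_norm_sub_add_norm_sub (catchingUp C x₀ h (k + (j + 1)))
      (catchingUp C x₀ h k) z
    push_cast at h3
    rw [← add_assoc] at h3 h4
    have h5 : ‖catchingUp C x₀ h (k + j + 1) - z‖ + δ ≤
        ‖catchingUp C x₀ h k - z‖ + m * h + δ := by linarith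
    have h6 : h * (‖catchingUp C x₀ h (k + j + 1) - z‖ + δ) ^ 2 ≤
        h * (‖catchingUp C x₀ h k - z‖ + m * h + δ) ^ 2 := by gcongr
    have h7 : h * B = h * (‖catchingUp C x₀ h k - z‖ + m * h + δ) ^ 2 + 2 * r * h * δ := by
      rw [hB]; ring
    rw [← add_assoc]
    push_cast
    linarith

/-- Comparison of one coarse step of the catching-up scheme with two steps of half the size. -/
theorem norm_sq_coarse_sub_fine_le (hr : 0 < r) (hC : ∀ t, 0 ≤ t → IsProxRegular r (C t))
    (hd : ∀ s t, 0 ≤ s → s ≤ t → ∀ x ∈ C s, Metric.infDist x (C t) ≤ t - s)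
    (h0 : 0 < h) (hh : 2 * h ≤ r) {t t₁ t₂ : ℝ} (ht : 0 ≤ t) (ht₁ : t₁ = t + h / 2)
    (ht₂ : t₂ = t + h) {u w p q₁ q₂ : H}
    (hu : u ∈ C t) (hw : w ∈ C t) (hp : p ∈ projSet (C t₂) u)
    (hq₁ : q₁ ∈ projSet (C t₁) w) (hq₂ : q₂ ∈ projSet (C t₂) q₁) :
    r * ‖p - q₂‖ ^ 2 ≤ (r + 4 * h) * ‖u - w‖ ^ 2 + 10 * r * h ^ 2 := by
  subst ht₁ ht₂
  have hpu : ‖p - u‖ ≤ h := by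
    rw [hp.2]; refine (hd t _ ht ?_ u hu).trans ?_ <;> linarith
  have hqw : ‖q₁ - w‖ ≤ h / 2 := by
    rw [hq₁.2]; refine (hd t _ ht ?_ w hw).trans ?_ <;> linarith
  have hqq : ‖q₂ - q₁‖ ≤ h / 2 := by
    rw [hq₂.2]; refine (hd (t + h / 2) _ (by positivity) ?_ q₁ hq₁.1).trans ?_ <;> linarith
  -- The chain is `‖p - q₂‖² ≲ ‖u - q₂‖² ≲ ‖u - q₁‖² ≲ ‖u - w‖²`. Only `e2` and `e3` test against a
  -- point outside the target set, namely `u` from the earlier time.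
  have e1 := (hC _ (by positivity)).norm_sq_projection_step_le hr hp hpu (z := q₂) (ε := 0)
    (Metric.infDist_zero_of_mem hq₂.1).le hr
  have e2 := (hC _ (by positivity)).norm_sq_projection_step_le hr hq₂ hqq (z := u) (ε := h)
    ((hd t _ ht (by linarith) u hu).trans (by linarith)) (by linarith)
  have e3 := (hC _ (by positivity)).norm_sq_projection_step_le hr hq₁ hqw (z := u) (ε := h / 2)
    ((hd t _ ht (by linarith) u hu).trans (by linarith)) (by linarith)
  set d := ‖u - w‖ with hdef
  have hwu : ‖w - u‖ = d := norm_sub_rev _ _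
  have d0 : 0 ≤ d := norm_nonneg _
  have f1 : ‖q₁ - u‖ ≤ d + h / 2 := by
    have := norm_sub_le_norm_sub_add_norm_sub q₁ w u
    linarith
  have f2 : ‖q₂ - u‖ ≤ d + h := by
    have := norm_sub_le_norm_sub_add_norm_sub q₂ q₁ u
    linarith
  have f3 : ‖p - q₂‖ ≤ d + 2 * h := by
    have := norm_sub_le_norm_sub_add_norm_sub p u q₂
    rw [norm_sub_rev u] at this
    linarith
  rw [norm_sub_rev u q₂] at e1
  rw [hwu] at e3
  have g1 : h * (‖p - q₂‖ + 0) ^ 2 ≤ h * (d + 2 * h) ^ 2 := by rw [add_zero]; gcongr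
  have g2 : h / 2 * (‖q₂ - u‖ + h) ^ 2 ≤ h / 2 * (d + 2 * h) ^ 2 :=
    mul_le_mul_of_nonneg_left (pow_le_pow_left₀ (by positivity) (by linarith) 2) (by positivity)
  have g3 : h / 2 * (‖q₁ - u‖ + h / 2) ^ 2 ≤ h / 2 * (d + 2 * h) ^ 2 :=
    mul_le_mul_of_nonneg_left (pow_le_pow_left₀ (by positivity) (by linarith) 2) (by positivity)
  have g4 : h * (d + 2 * h) ^ 2 ≤ h * (2 * d ^ 2 + 8 * h ^ 2) := by
    gcongr
    nlinarith [sq_nonneg (d - 2 * h)]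
  have g5 : h ^ 2 * (2 * h) ≤ h ^ 2 * r := by gcongr
  -- The quadratic errors total at most `2h(2d² + 8h²) ≤ 4hd² + 8rh²`; the terms `2rhε` add
  -- `3rh²/2`, so `10` suffices.
  nlinarith [mul_nonneg hr.le (sq_nonneg h)]

/-- Discrete Gronwall for the one-step comparison; both schemes start at `x₀`. -/
theorem norm_sq_catchingUp_sub_half_le (hr : 0 < r) (hC : ∀ t, 0 ≤ t → IsProxRegular r (C t))
    (hd : ∀ s t, 0 ≤ s → s ≤ t → ∀ x ∈ C s, Metric.infDist x (C t) ≤ t - s) (hx₀ : x₀ ∈ C 0)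
    (h0 : 0 < h) (hh : 2 * h ≤ r) (k : ℕ) :
    ‖catchingUp C x₀ h k - catchingUp C x₀ (h / 2) (2 * k)‖ ^ 2 ≤
      10 * h ^ 2 * k * (1 + 4 * h / r) ^ k := by
  induction k with
  | zero => simp [catchingUp]
  | succ k ih =>
    obtain ⟨a1, a2⟩ := catchingUp_mem_projSet hC hd hx₀ h0 (by linarith) k
    obtain ⟨b1, b2⟩ := catchingUp_mem_projSet hC hd hx₀ (half_pos h0) (by linarith) (2 * k)
    obtain ⟨-, b3⟩ := catchingUp_mem_projSet hC hd hx₀ (half_pos h0) (by linarith) (2 * k + 1)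
    have hk : ((2 * k : ℕ) : ℝ) * (h / 2) = k * h := by push_cast; ring
    rw [hk] at b1
    have hk2 : ((2 * k + 1 + 1 : ℕ) : ℝ) * (h / 2) = (k + 1 : ℕ) * h := by push_cast; ring
    rw [hk2] at b3
    have e := norm_sq_coarse_sub_fine_le hr hC hd h0 hh (t := k * h) (by positivity)
      (by push_cast; ring) (by push_cast; ring) a1 b1 a2 b2 b3
    set q := 1 + 4 * h / r with hq
    have hq1 : 1 ≤ q := by rw [hq]; linarith [show 0 ≤ 4 * h / r by positivity]
    have hrq : r + 4 * h = r * q := by rw [hq]; field_simp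
    rw [hrq] at e
    have e' : ‖catchingUp C x₀ h (k + 1) - catchingUp C x₀ (h / 2) (2 * k + 1 + 1)‖ ^ 2 ≤
        q * ‖catchingUp C x₀ h k - catchingUp C x₀ (h / 2) (2 * k)‖ ^ 2 + 10 * h ^ 2 := by
      refine le_of_mul_le_mul_left ?_ hr
      linarith
    have e2 := mul_le_mul_of_nonneg_left ih (zero_le_one.trans hq1)
    have e3 : 1 ≤ q ^ (k + 1) := one_le_pow₀ hq1
    have e4 : 10 * h ^ 2 * 1 ≤ 10 * h ^ 2 * q ^ (k + 1) := by gcongr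
    rw [show 2 * (k + 1) = 2 * k + 1 + 1 by ring]
    push_cast
    calc _ ≤ q * (10 * h ^ 2 * k * q ^ k) + 10 * h ^ 2 * q ^ (k + 1) := by linarith
      _ = 10 * h ^ 2 * (k + 1) * q ^ (k + 1) := by ring

theorem norm_catchingUpStep_sub_half_le (hr : 0 < r) (hC : ∀ t, 0 ≤ t → IsProxRegular r (C t))
    (hd : ∀ s t, 0 ≤ s → s ≤ t → ∀ x ∈ C s, Metric.infDist x (C t) ≤ t - s) (hx₀ : x₀ ∈ C 0)
    (h0 : 0 < h) (hh : 2 * h ≤ r) {t : ℝ} (ht : 0 ≤ t) :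
    ‖catchingUpStep C x₀ h t - catchingUpStep C x₀ (h / 2) t‖ ≤
      √(10 * t * Real.exp (4 * t / r) * h) + h := by
  rw [catchingUpStep, catchingUpStep]
  set k := ⌊t / h⌋₊ with hk
  set m := ⌊t / (h / 2)⌋₊ with hm
  have k1 : (k : ℝ) * h ≤ t := (le_div_iff₀ h0).1 (Nat.floor_le (by positivity))
  have k2 : t < (k + 1) * h := (div_lt_iff₀ h0).1 (Nat.lt_floor_add_one _)
  have m1 : (m : ℝ) * (h / 2) ≤ t :=
    (le_div_iff₀ (half_pos h0)).1 (Nat.floor_le (by positivity))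
  have m2 : t < (m + 1) * (h / 2) := (div_lt_iff₀ (half_pos h0)).1 (Nat.lt_floor_add_one _)
  -- The fine index is `2k` or `2k + 1`, so at most one extra fine step, of length at most `h / 2`,
  -- separates it from `2k`.
  have c1 : 2 * k < m + 1 := by
    have : (2 * k : ℝ) < m + 1 := by nlinarith
    exact_mod_cast this
  have c2 : m < 2 * (k + 1) := by
    have : (m : ℝ) < 2 * (k + 1) := by nlinarith
    exact_mod_cast this
  clear_value m
  obtain ⟨j, rfl⟩ : ∃ j, m = 2 * k + j := ⟨m - 2 * k, by omega⟩
  have hj : (j : ℝ) ≤ 1 := by exact_mod_cast (by omega : j ≤ 1)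
  have e1 := norm_sq_catchingUp_sub_half_le hr hC hd hx₀ h0 hh k
  have e2 := norm_catchingUp_add_sub_le hC hd hx₀ (half_pos h0) (by linarith) (2 * k) j
  have e3 : (1 + 4 * h / r) ^ k ≤ Real.exp (4 * t / r) := by
    calc (1 + 4 * h / r) ^ k ≤ Real.exp (4 * h / r) ^ k := by
          gcongr
          linarith [Real.add_one_le_exp (4 * h / r)]
      _ = Real.exp (4 * (k * h) / r) := by rw [← Real.exp_nat_mul]; ring_nf
      _ ≤ _ := by gcongr
  have e4 : 10 * h ^ 2 * k * (1 + 4 * h / r) ^ k ≤ 10 * t * Real.exp (4 * t / r) * h := by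
    calc 10 * h ^ 2 * k * (1 + 4 * h / r) ^ k
        = 10 * (k * h) * (1 + 4 * h / r) ^ k * h := by ring
      _ ≤ _ := by gcongr
  have e5 := Real.le_sqrt_of_sq_le (e1.trans e4)
  have e6 := norm_sub_le_norm_sub_add_norm_sub (catchingUp C x₀ h k)
    (catchingUp C x₀ (h / 2) (2 * k)) (catchingUp C x₀ (h / 2) (2 * k + j))
  rw [norm_sub_rev (catchingUp C x₀ (h / 2) (2 * k))] at e6
  have e7 : (j : ℝ) * (h / 2) ≤ 1 * (h / 2) := by gcongr
  linarith

theorem norm_catchingUpStep_sub_le (hC : ∀ t, 0 ≤ t → IsProxRegular r (C t))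
    (hd : ∀ s t, 0 ≤ s → s ≤ t → ∀ x ∈ C s, Metric.infDist x (C t) ≤ t - s) (hx₀ : x₀ ∈ C 0)
    (h0 : 0 < h) (hh : h < r) {s t : ℝ} (hs : 0 ≤ s) (hst : s ≤ t) :
    ‖catchingUpStep C x₀ h t - catchingUpStep C x₀ h s‖ ≤ t - s + h := by
  rw [catchingUpStep, catchingUpStep]
  have k2 : s < (⌊s / h⌋₊ + 1) * h := (div_lt_iff₀ h0).1 (Nat.lt_floor_add_one _)
  have m1 : (⌊t / h⌋₊ : ℝ) * h ≤ t :=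
    (le_div_iff₀ h0).1 (Nat.floor_le (div_nonneg (hs.trans hst) h0.le))
  obtain ⟨j, hj⟩ := Nat.exists_eq_add_of_le (show ⌊s / h⌋₊ ≤ ⌊t / h⌋₊ by gcongr)
  rw [hj] at m1 ⊢
  push_cast at m1
  have := norm_catchingUp_add_sub_le hC hd hx₀ h0 hh ⌊s / h⌋₊ j
  linarith

theorem infDist_catchingUpStep_le (hC : ∀ t, 0 ≤ t → IsProxRegular r (C t))
    (hd : ∀ s t, 0 ≤ s → s ≤ t → ∀ x ∈ C s, Metric.infDist x (C t) ≤ t - s) (hx₀ : x₀ ∈ C 0)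
    (h0 : 0 < h) (hh : h < r) {t : ℝ} (ht : 0 ≤ t) :
    Metric.infDist (catchingUpStep C x₀ h t) (C t) ≤ h := by
  have k1 : (⌊t / h⌋₊ : ℝ) * h ≤ t := (le_div_iff₀ h0).1 (Nat.floor_le (by positivity))
  have k2 : t < (⌊t / h⌋₊ + 1) * h := (div_lt_iff₀ h0).1 (Nat.lt_floor_add_one _)
  refine (hd _ t (by positivity) k1 _
    (catchingUp_mem_projSet hC hd hx₀ h0 hh ⌊t / h⌋₊).1).trans ?_
  linarith

theorem catchingUpStep_norm_sq_le (hC : ∀ t, 0 ≤ t → IsProxRegular r (C t))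
    (hd : ∀ s t, 0 ≤ s → s ≤ t → ∀ x ∈ C s, Metric.infDist x (C t) ≤ t - s) (hx₀ : x₀ ∈ C 0)
    (h0 : 0 < h) (hh : h < r) {t δ : ℝ} (ht : 0 ≤ t) (hδ0 : 0 ≤ δ) (hδ : δ < r) {z : H}
    (hz : z ∈ C t) :
    r * ‖catchingUpStep C x₀ h (t + δ) - z‖ ^ 2 ≤ r * ‖catchingUpStep C x₀ h t - z‖ ^ 2 +
      (δ + h) * ((‖catchingUpStep C x₀ h t - z‖ + (δ + h) + δ) ^ 2 + 2 * r * δ) := by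
  rw [catchingUpStep, catchingUpStep]
  have hr : 0 < r := h0.trans hh
  have k2 : t < (⌊t / h⌋₊ + 1) * h := (div_lt_iff₀ h0).1 (Nat.lt_floor_add_one _)
  have m1 : (⌊(t + δ) / h⌋₊ : ℝ) * h ≤ t + δ :=
    (le_div_iff₀ h0).1 (Nat.floor_le (by positivity))
  obtain ⟨j, hj⟩ := Nat.exists_eq_add_of_le
    (show ⌊t / h⌋₊ ≤ ⌊(t + δ) / h⌋₊ by gcongr; linarith)
  rw [hj] at m1 ⊢
  push_cast at m1
  refine (catchingUp_norm_sq_le hC hd hx₀ h0 hh ht hδ hz k2.le m1).trans ?_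
  have hjh : j * h ≤ δ + h := by linarith
  gcongr

/-- The catching-up schemes converge to a `1`-Lipschitz curve in the moving set that satisfies an
evolution variational inequality. -/
theorem exists_lipschitz_evi_curve [CompleteSpace H] (hr : 0 < r)
    (hC : ∀ t, 0 ≤ t → IsProxRegular r (C t))
    (hd : ∀ s t, 0 ≤ s → s ≤ t → ∀ x ∈ C s, Metric.infDist x (C t) ≤ t - s) (hx₀ : x₀ ∈ C 0) :
    ∃ y : ℝ → H, y 0 = x₀ ∧ LipschitzOnWith 1 y (Ici 0) ∧ (∀ t, 0 ≤ t → y t ∈ C t) ∧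
      ∀ t, 0 ≤ t → ∀ z ∈ C t, ∀ δ, 0 ≤ δ → δ < r → r * ‖y (t + δ) - z‖ ^ 2 ≤
        r * ‖y t - z‖ ^ 2 + δ * ((‖y t - z‖ + δ + δ) ^ 2 + 2 * r * δ) := by
  let h : ℕ → ℝ := fun n => r / 2 / 2 ^ n
  have h0 : ∀ n, 0 < h n := fun n => by positivity
  have hh : ∀ n, 2 * h n ≤ r := fun n => by
    have : h n ≤ r / 2 := div_le_self (by positivity) (one_le_pow₀ one_le_two)
    linarith
  have hlt : ∀ n, h n < r := fun n => by linarith [hh n, h0 n]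
  have hsucc : ∀ n, h (n + 1) = h n / 2 := fun n => by simp only [h, pow_succ]; field_simp
  have hlim : Tendsto h atTop (𝓝 0) :=
    tendsto_const_nhds.div_atTop (tendsto_pow_atTop_atTop_of_one_lt one_lt_two)
  have hcauchy : ∀ t, 0 ≤ t → CauchySeq fun n => catchingUpStep C x₀ (h n) t := by
    intro t ht
    -- Halving the step multiplies `√h` by `q`, the ratio of the dominating geometric series; the
    -- linear term `h` decays faster.
    set q : ℝ := √(1 / 2) with hq
    have hq1 : q < 1 := by rw [hq, Real.sqrt_lt' one_pos]; norm_num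
    have hq0 : 0 ≤ q := Real.sqrt_nonneg _
    have hqsq : q ^ 2 = 1 / 2 := Real.sq_sqrt (by norm_num)
    have hhq : ∀ n, h n = r / 2 * (q ^ n) ^ 2 := fun n => by
      rw [← pow_mul, mul_comm n, pow_mul, hqsq]
      simp [h, div_eq_mul_inv]
    refine cauchySeq_of_le_geometric q (√(10 * t * Real.exp (4 * t / r) * (r / 2)) + r / 2) hq1
      fun n => ?_
    have hqn : 0 ≤ q ^ n := by positivity
    have hqn1 : q ^ n ≤ 1 := pow_le_one₀ hq0 hq1.le
    rw [dist_eq_norm, hsucc]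
    refine (norm_catchingUpStep_sub_half_le hr hC hd hx₀ (h0 n) (hh n) ht).trans ?_
    rw [hhq n, ← mul_assoc, Real.sqrt_mul (by positivity), Real.sqrt_sq hqn, add_mul]
    gcongr
    nlinarith
  choose! y hy using fun t ht => cauchySeq_tendsto_of_complete (hcauchy t ht)
  refine ⟨y, ?_, ?_, ?_, ?_⟩
  · refine tendsto_nhds_unique (hy 0 le_rfl) ?_
    simp [catchingUpStep, catchingUp]
  · have key : ∀ s t, 0 ≤ s → s ≤ t → ‖y t - y s‖ ≤ t - s := by
      intro s t hs hst
      have h1 : Tendsto (fun n => t - s + h n) atTop (𝓝 (t - s)) := by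
        simpa using hlim.const_add (t - s)
      exact le_of_tendsto_of_tendsto' ((hy t (hs.trans hst)).sub (hy s hs)).norm h1 fun n =>
        norm_catchingUpStep_sub_le hC hd hx₀ (h0 n) (hlt n) hs hst
    refine LipschitzOnWith.of_dist_le_mul fun s hs t ht => ?_
    rw [NNReal.coe_one, one_mul]
    rcases le_total s t with hst | hst
    · rw [dist_comm, dist_comm s, dist_eq_norm, Real.dist_eq, abs_of_nonneg (sub_nonneg.2 hst)]
      exact key s t hs hst
    · rw [dist_eq_norm, Real.dist_eq, abs_of_nonneg (sub_nonneg.2 hst)]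
      exact key t s ht hst
  · intro t ht
    rw [(hC t ht).isClosed.mem_iff_infDist_zero (hC t ht).nonempty]
    refine le_antisymm ?_ Metric.infDist_nonneg
    exact le_of_tendsto_of_tendsto'
      (((Metric.continuous_infDist_pt (C t)).tendsto _).comp (hy t ht)) hlim fun n =>
        infDist_catchingUpStep_le hC hd hx₀ (h0 n) (hlt n) ht
  · intro t ht z hz δ hδ0 hδ
    have a1 := ((hy (t + δ) (by positivity)).sub_const z).norm
    have a2 := ((hy t ht).sub_const z).norm
    have a3 : Tendsto (fun n => δ + h n) atTop (𝓝 δ) := by simpa using hlim.const_add δ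
    exact le_of_tendsto_of_tendsto' ((a1.pow 2).const_mul r)
      (((a2.pow 2).const_mul r).add
        (a3.mul ((((a2.add a3).add_const δ).pow 2).add_const (2 * r * δ)))) fun n =>
      catchingUpStep_norm_sq_le hC hd hx₀ (h0 n) (hlt n) ht hδ0 hδ hz

end CatchingUp

/-! ### Differentiating the variational inequality; speed bound and uniqueness. -/

theorem HasDerivAt.nonneg_of_eventually_nonneg_right {f : ℝ → ℝ} {f' : ℝ}
    (hf : HasDerivAt f f' 0) (h0 : f 0 = 0) (h : ∀ᶠ s in 𝓝[>] 0, 0 ≤ f s) : 0 ≤ f' := by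
  refine ge_of_tendsto hf.tendsto_slope_zero_right ?_
  filter_upwards [h, self_mem_nhdsWithin] with s hs hs0
  have : (0 : ℝ) < s := hs0
  rw [zero_add, h0, sub_zero, smul_eq_mul]
  positivity

theorem AbsolutelyContinuousOnInterval.norm {E : Type*} [NormedAddCommGroup E] {f : ℝ → E}
    {a b : ℝ} (hf : AbsolutelyContinuousOnInterval f a b) :
    AbsolutelyContinuousOnInterval (fun t => ‖f t‖) a b := by
  rw [absolutelyContinuousOnInterval_iff] at hf ⊢
  intro ε hε
  obtain ⟨δ, hδ, h⟩ := hf ε hε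
  refine ⟨δ, hδ, fun E hE hs => (Finset.sum_le_sum fun i _ => ?_).trans_lt (h E hE hs)⟩
  exact (dist_norm_norm_le (f _) (f _)).trans_eq (dist_eq_norm _ _).symm

section Sweeping

variable {H : Type*} [NormedAddCommGroup H] [InnerProductSpace ℝ H] {r : ℝ}

/-- Both sides of the variational inequality agree at `δ = 0`, so their right derivatives are
ordered: `2r⟨y t - z, v⟩ ≤ ‖y t - z‖²`. -/
theorem neg_mem_normalCone_of_evi {K : Set H} {y : ℝ → H} {t : ℝ} {v : H} (hr : 0 < r)
    (hyt : y t ∈ K) (hv : HasDerivAt y v t)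
    (hevi : ∀ z ∈ K, ∀ δ, 0 ≤ δ → δ < r → r * ‖y (t + δ) - z‖ ^ 2 ≤
      r * ‖y t - z‖ ^ 2 + δ * ((‖y t - z‖ + δ + δ) ^ 2 + 2 * r * δ)) :
    -v ∈ normalCone K (y t) := by
  refine mem_normalCone_of_inner_le hr hyt fun z hz => ?_
  have hv' : HasDerivAt (fun δ => y (t + δ)) v 0 :=
    HasDerivAt.comp_const_add t 0 (by rwa [add_zero])
  have h1 := ((hv'.sub_const z).norm_sq).const_mul r
  have h2 : HasDerivAt (fun δ : ℝ => (‖y t - z‖ + δ + δ) ^ 2 + 2 * r * δ)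
      (2 * ‖y t - z‖ * 2 + 2 * r) 0 := by
    have := (((((hasDerivAt_id (0 : ℝ)).const_add ‖y t - z‖).add (hasDerivAt_id 0)).pow 2).add
      ((hasDerivAt_id 0).const_mul (2 * r)))
    refine this.congr_deriv ?_
    simp only [Pi.add_apply, id, Nat.cast_ofNat]
    ring
  have h3 := (((hasDerivAt_id (0 : ℝ)).mul h2).const_add (r * ‖y t - z‖ ^ 2)).sub h1
  have h4 := h3.nonneg_of_eventually_nonneg_right (by simp) (by
    filter_upwards [Ioo_mem_nhdsGT hr] with δ hδ
    have := hevi z hz δ hδ.1.le hδ.2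
    simp only [Pi.sub_apply, Pi.mul_apply, id]
    linarith)
  simp only [id, add_zero, one_mul, zero_mul, mul_zero] at h4
  rw [inner_neg_left, ← inner_neg_right, neg_sub, norm_sub_rev z, real_inner_comm]
  linarith

/-- A solution moving inside a set whose excess grows at unit rate has speed at most one. -/
theorem norm_le_one_of_neg_mem_normalCone {C : ℝ → Set H} (hr : 0 < r) {t : ℝ} (ht : 0 < t)
    (hK : IsProxRegular r (C t))
    (hd : ∀ s, 0 ≤ s → s ≤ t → ∀ x ∈ C s, Metric.infDist x (C t) ≤ t - s) {y : ℝ → H} {v : H}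
    (hy : ∀ s, 0 ≤ s → y s ∈ C s) (hv : HasDerivAt y v t) (hN : -v ∈ normalCone (C t) (y t)) :
    ‖v‖ ≤ 1 := by
  -- Time runs backward, which requires `0 < t`: `y (t - δ)` is within `δ` of `C t`, and its
  -- projection `c` tests the normal `-v`. The resulting inequality is an equality at `δ = 0`; its
  -- squared terms have zero derivative there, leaving `2r‖v‖ - 2r‖v‖² ≥ 0`.
  have hv' : HasDerivAt (fun δ => y (t - δ) - y t) (-v) 0 :=
    (HasDerivAt.comp_const_sub t 0 (by rwa [sub_zero])).sub_const (y t)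
  have h1 := (hv'.norm_sq.const_mul 2).add (((hasDerivAt_id (0 : ℝ)).pow 2).const_mul 2)
  have h2 := (h1.const_mul ‖v‖).add ((hasDerivAt_id (0 : ℝ)).const_mul (2 * r * ‖v‖))
  have h3 := h2.sub (((hasDerivAt_const (0 : ℝ) (-v)).inner ℝ hv').const_mul (2 * r))
  have h4 := h3.nonneg_of_eventually_nonneg_right (by simp) (by
    filter_upwards [Ioo_mem_nhdsGT (lt_min hr ht)] with δ hδ
    have hδr := hδ.2.trans_le (min_le_left _ _)
    have hδt := hδ.2.trans_le (min_le_right _ _)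
    have hinf : Metric.infDist (y (t - δ)) (C t) ≤ δ := by
      have := hd (t - δ) (by linarith) (by linarith [hδ.1]) _ (hy _ (by linarith))
      linarith
    obtain ⟨c, hc⟩ := hK.projSet_nonempty (hinf.trans_lt hδr)
    have hcd : ‖c - y (t - δ)‖ ≤ δ := hc.2.trans_le hinf
    have e1 := hK.inner_le_of_mem_normalCone hr hN hc.1
    rw [norm_neg] at e1
    have e2 : ‖c - y t‖ ^ 2 ≤ 2 * ‖y (t - δ) - y t‖ ^ 2 + 2 * δ ^ 2 := by
      have e3 : ‖c - y t‖ ≤ δ + ‖y (t - δ) - y t‖ := by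
        have := norm_sub_le_norm_sub_add_norm_sub c (y (t - δ)) (y t)
        linarith
      calc ‖c - y t‖ ^ 2 ≤ (δ + ‖y (t - δ) - y t‖) ^ 2 := by gcongr
        _ ≤ _ := by nlinarith [sq_nonneg (δ - ‖y (t - δ) - y t‖)]
    have e4 : inner ℝ (-v) (y (t - δ) - y t) =
        inner ℝ (-v) (c - y t) - inner ℝ (-v) (c - y (t - δ)) := by
      rw [← inner_sub_right]
      congr 1
      abel
    have e5 : -(‖v‖ * δ) ≤ inner ℝ (-v) (c - y (t - δ)) := by
      have := neg_le_of_abs_le (abs_real_inner_le_norm (-v) (c - y (t - δ)))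
      rw [norm_neg] at this
      have : ‖v‖ * ‖c - y (t - δ)‖ ≤ ‖v‖ * δ := by gcongr
      linarith
    have e6 := mul_le_mul_of_nonneg_left e2 (norm_nonneg v)
    have e7 := mul_le_mul_of_nonneg_left e5 hr.le
    simp only [Pi.sub_apply, Pi.add_apply, Pi.pow_apply, id]
    rw [e4]
    linarith)
  simp at h4
  have h5 : ‖v‖ * ‖v‖ ≤ 1 * ‖v‖ := by
    refine le_of_mul_le_mul_left ?_ (by positivity : 0 < 2 * r)
    nlinarith
  rcases (norm_nonneg v).eq_or_lt with h0 | h0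
  · rw [← h0]; exact zero_le_one
  · exact le_of_mul_le_mul_right h5 h0

theorem IsSweepingSolution.eq_of_prox_regular {C : ℝ → Set H} (hr : 0 < r)
    (hC : ∀ t, 0 ≤ t → IsProxRegular r (C t))
    (hd : ∀ s t, 0 ≤ s → s ≤ t → ∀ x ∈ C s, Metric.infDist x (C t) ≤ t - s) {y₀ : H}
    {y z : ℝ → H} (hy : IsSweepingSolution C y₀ y) (hz : IsSweepingSolution C y₀ z) {T : ℝ}
    (hT : 0 < T) : y T = z T := by
  have hderiv : ∀ x, IsSweepingSolution C y₀ x → ∀ᵐ t, 0 < t →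
      ∃ v, HasDerivAt x v t ∧ ‖v‖ ≤ 1 ∧ -v ∈ normalCone (C t) (x t) := by
    intro x hx
    filter_upwards [(ae_restrict_iff' measurableSet_Ici).1 hx.inclusion] with t ht ht0
    obtain ⟨v, hv, hN⟩ := ht ht0.le
    have hv' := hv.hasDerivAt (Ici_mem_nhds ht0)
    exact ⟨v, hv', norm_le_one_of_neg_mem_normalCone hr ht0 (hC t ht0.le)
      (fun s hs hst => hd s t hs hst) hx.mem hv' hN, hN⟩
  -- Gronwall weight: the two normal inequalities with speeds at most `1` bound the growth rate of
  -- `‖y - z‖²` by `2 / r`. Absolute continuity then turns `deriv g ≤ 0` almost everywhere into `g T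
  -- ≤ g 0 = 0`.
  let g : ℝ → ℝ := fun t => Real.exp (-(2 / r) * t) * (‖y t - z t‖ * ‖y t - z t‖)
  have hn := ((hy.absCont T hT).sub (hz.absCont T hT)).norm
  have hexp : AbsolutelyContinuousOnInterval (fun t => Real.exp (-(2 / r) * t)) 0 T :=
    ContDiffOn.absolutelyContinuousOnInterval (by fun_prop)
  have hg : AbsolutelyContinuousOnInterval g 0 T := hexp.mul (hn.mul hn)
  have hneg : ∀ᵐ t, 0 < t → deriv g t ≤ 0 := by
    filter_upwards [hderiv y hy, hderiv z hz] with t h1 h2 ht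
    obtain ⟨v, hv, hv1, hvN⟩ := h1 ht
    obtain ⟨w, hw, hw1, hwN⟩ := h2 ht
    have e1 := (hC t ht.le).inner_le_of_mem_normalCone hr hvN (hz.mem t ht.le)
    have e2 := (hC t ht.le).inner_le_of_mem_normalCone hr hwN (hy.mem t ht.le)
    rw [norm_neg, norm_sub_rev] at e1
    rw [norm_neg] at e2
    have e3 : ‖v‖ * ‖y t - z t‖ ^ 2 ≤ 1 * ‖y t - z t‖ ^ 2 := by gcongr
    have e4 : ‖w‖ * ‖y t - z t‖ ^ 2 ≤ 1 * ‖y t - z t‖ ^ 2 := by gcongr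
    have e5 : inner ℝ (-v) (z t - y t) + inner ℝ (-w) (y t - z t) =
        inner ℝ (y t - z t) (v - w) := by
      rw [← neg_sub (y t) (z t), inner_neg_neg, inner_neg_left, ← sub_eq_add_neg,
        ← inner_sub_left, real_inner_comm]
    have hφ : HasDerivAt (fun s => ‖y s - z s‖ * ‖y s - z s‖)
        (2 * inner ℝ (y t - z t) (v - w)) t := by
      simpa only [sq, Pi.sub_apply] using (hv.sub hw).norm_sq
    have hE : HasDerivAt (fun s => Real.exp (-(2 / r) * s))
        (Real.exp (-(2 / r) * t) * (-(2 / r))) t := by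
      simpa using ((hasDerivAt_id t).const_mul (-(2 / r))).exp
    have hg' : HasDerivAt g _ t := hE.mul hφ
    rw [hg'.deriv, mul_assoc, ← mul_add]
    refine mul_nonpos_of_nonneg_of_nonpos (Real.exp_nonneg _) ?_
    refine nonpos_of_mul_nonpos_right (a := r) ?_ hr
    have e6 : r * (-(2 / r) * (‖y t - z t‖ * ‖y t - z t‖) + 2 * inner ℝ (y t - z t) (v - w)) =
        -2 * ‖y t - z t‖ ^ 2 + 2 * r * inner ℝ (y t - z t) (v - w) := by
      field_simp
    rw [e6, ← e5]
    linarith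
  have hint : ∫ t in (0 : ℝ)..T, deriv g t ≤ 0 := by
    rw [intervalIntegral.integral_of_le hT.le]
    refine integral_nonpos_of_ae ?_
    filter_upwards [ae_restrict_of_ae hneg, ae_restrict_mem measurableSet_Ioc] with t ht ht0
    exact ht ht0.1
  rw [hg.integral_deriv_eq_sub] at hint
  have h0 : y 0 = z 0 := singleton_injective (hy.initial.symm.trans hz.initial)
  have hg0 : g 0 = 0 := by simp [g, h0]
  have hgT : g T ≤ 0 := by linarith
  have h1 : ‖y T - z T‖ * ‖y T - z T‖ ≤ 0 := nonpos_of_mul_nonpos_right hgT (Real.exp_pos _)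
  have h2 : ‖y T - z T‖ = 0 := mul_self_eq_zero.1 (le_antisymm h1 (mul_self_nonneg _))
  exact sub_eq_zero.1 (norm_eq_zero.1 h2)

end Sweeping

/-! ### Assembly of the main theorem. -/

theorem infDist_le_of_excess_le {H : Type*} [NormedAddCommGroup H] {Z₁ Z₂ : Set H} {a : ℝ}
    (ha : 0 ≤ a) (h : excess Z₁ Z₂ ≤ ENNReal.ofReal a) {x : H} (hx : x ∈ Z₁) :
    Metric.infDist x Z₂ ≤ a :=
  ENNReal.toReal_le_of_le_ofReal ha ((le_iSup₂ (f := fun z _ => Metric.infEDist z Z₂) x hx).trans h)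

theorem mainTheorem2 {H : Type*} [NormedAddCommGroup H] [InnerProductSpace ℝ H]
    [CompleteSpace H] (r : ℝ) (hr : 0 < r) (C : ℝ → Set H)
    (hC : ∀ t : ℝ, 0 ≤ t → IsProxRegular r (C t))
    (hLip : ∀ s t : ℝ, 0 ≤ s → s < t → excess (C s) (C t) ≤ ENNReal.ofReal (t - s))
    (y₀ : H) (hy₀ : ∃ c ∈ C 0, ∃ b ∈ Metric.ball (0 : H) r, y₀ = c + b) :
    ∃ y : ℝ → H, IsSweepingSolution C y₀ y ∧
      (∀ z : ℝ → H, IsSweepingSolution C y₀ z → Set.EqOn z y (Set.Ici 0)) ∧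
      LipschitzOnWith 1 y (Set.Ici 0) := by
  have hd : ∀ s t, 0 ≤ s → s ≤ t → ∀ x ∈ C s, Metric.infDist x (C t) ≤ t - s := by
    intro s t hs hst x hx
    rcases hst.eq_or_lt with rfl | hst
    · rw [Metric.infDist_zero_of_mem hx, sub_self]
    · exact infDist_le_of_excess_le (sub_nonneg.2 hst.le) (hLip s t hs hst) hx
  have h0 : Metric.infDist y₀ (C 0) < r := by
    obtain ⟨c, hc, b, hb, rfl⟩ := hy₀
    refine (Metric.infDist_le_dist_of_mem hc).trans_lt ?_
    simpa [dist_eq_norm] using hb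
  obtain ⟨x₀, hx₀⟩ := (hC 0 le_rfl).projSet_nonempty h0
  obtain ⟨y, hy0, hyL, hymem, hevi⟩ := exists_lipschitz_evi_curve hr hC hd hx₀.1
  -- Constant extension to negative times makes the curve Lipschitz on the whole line. It agrees
  -- with `y` near every `t > 0`, and the point `0` is negligible.
  have hext : LipschitzWith 1 (fun t => y (max t 0)) := by
    have h1 : LipschitzWith 1 (fun t : ℝ => max t 0) := LipschitzWith.id.max_const 0
    have := hyL.comp h1.lipschitzOnWith (s := univ) fun t _ => le_max_right t 0
    rwa [mul_one, lipschitzOnWith_univ] at this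
  have hsol : IsSweepingSolution C y₀ y := by
    refine ⟨fun T hT => ?_, hymem, ?_, ?_⟩
    · refine (hyL.mono fun t ht => ?_).absolutelyContinuousOnInterval
      rw [uIcc_of_le hT.le] at ht
      exact ht.1
    · rw [ae_restrict_iff' measurableSet_Ici]
      filter_upwards [hext.ae_differentiableAt_of_hilbert, Measure.ae_ne volume (0 : ℝ)]
        with t ht hne ht0
      have htpos : 0 < t := lt_of_le_of_ne ht0 (Ne.symm hne)
      have heq : y =ᶠ[𝓝 t] fun s => y (max s 0) := by
        filter_upwards [Ioi_mem_nhds htpos] with s hs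
        rw [max_eq_left hs.le]
      have hv := ht.hasDerivAt.congr_of_eventuallyEq heq
      exact ⟨_, hv.hasDerivWithinAt,
        neg_mem_normalCone_of_evi hr (hymem t ht0) hv (hevi t ht0)⟩
    · rw [hy0]
      exact ((hC 0 le_rfl).projSet_subsingleton hr h0).eq_singleton_of_mem hx₀
  refine ⟨y, hsol, fun z hz t ht => ?_, hyL⟩
  rcases (show (0 : ℝ) ≤ t from ht).eq_or_lt with rfl | ht
  · exact singleton_injective (hz.initial.symm.trans hsol.initial)
  · exact hz.eq_of_prox_regular hr hC hd hsol ht
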